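/- Consider a Markov decision process with measurable state space $\mathcal S$, finite nonempty action set $\mathcal A$, discount factor $\gamma\in(0,1)$, and, for every $(s,a)$, a joint law (measurable in $(s,a)$) of the random reward $\tilde r(s,a)$ and the next state $\tilde s'$; the rewards are almost surely bounded, uniformly in $(s,a)$. For a real random variable $\tilde x$ and $\alpha\in(0,1)$ let $q^-_\alpha(\tilde x)=\min\{x: P[\tilde x\le x]\ge\alpha\}$ and $\mathrm{VaR}_\alpha[\tilde x]=q^+_\alpha(\tilde x)=\max\{x: P[\tilde x<x]\le\alpha\}$. For $s\in\mathcal S$ and $\alpha\in(0,1)$ let $$v^*(s,\alpha)=\max_{\pi}\ \mathrm{VaR}^{\pi}_\alpha\Big[\sum_{t=0}^{\infty}\gamma^t\,\tilde r(\tilde s_t,\tilde a_t)\ \Big|\ \tilde s_0=s\Big],$$ the maximum being over all (possibly randomized) history-dependent policies, i.e. policies choosing $\tilde a_t$ from $(s_0,a_0,r_0,s_1,\dots,s_t)$. For $\epsilon,\kappa\ge 0$ let $\partial l^\kappa_{\epsilon,\alpha}=\partial l^\kappa_{\max(\epsilon,\min(1-\epsilon,\alpha))}$, where $\partial l^\kappa_\alpha(\delta)$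 equals $(1-\alpha)(\kappa\delta+\kappa^2-1)$ if $\delta<-\kappa$, $\frac{1-\alpha}{\kappa}\delta$ if $\delta\in[-\kappa,0)$, $\frac{\alpha}{\kappa}\delta$ if $\delta\in[0,\kappa)$, and $\alpha(\kappa\delta-\kappa^2+1)$ if $\delta\ge\kappa$. For a step size $\eta>0$ and a bounded measurable $v:\mathcal S\times(0,1)\to\mathbb R$ let $$\mathcal T^*_{\epsilon,\kappa}v(s,\alpha)=v(s,\alpha)+\eta\max_{a\in\mathcal A}\mathbb E\big[\partial l^\kappa_{\epsilon,\alpha}\big(\tilde r(s,a)+\gamma v(\tilde s',\tilde u)-v(s,\alpha)\big)\big],$$ where $\tilde u$ is uniform on $[0,1]$ and independent of $(\tilde r(s,a),\tilde s')$. In particular, for $\epsilon=\kappa=0$ one has $\partial l^0_{0,\alpha}(\delta)=\alpha-\mathbb I\{\delta<0\}$, the derivative of the plain quantile loss. Assume that for every $(s,a)$ the random variable $\tilde x=\tilde r(s,a)+\gamma v^*(\tilde s',\tilde u)$ has a density and that its quantiles are unique, i.e. $q^-_\alpha(\tilde x)=q^+_\alpha(\tilde x)$ for all $\alpha\in(0,1)$.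 Then the maximum defining $v^*$ is attained, $v^*$ is bounded and measurable, and $v^*$ is the unique fixed point of $\mathcal T^*_{0,0}$ among bounded measurable functions $v:\mathcal S\times(0,1)\to\mathbb R$. -/

import Mathlib

open MeasureTheory ProbabilityTheory

noncomputable section

/-- Quantile levels strictly between `0` and `1`. -/
abbrev Level : Type := Set.Ioo (0 : ℝ) 1

/-- The uniform distribution on levels (Lebesgue measure on the open unit interval). -/
def uniformLevel : Measure Level := Measure.comap Subtype.val volume

/-- Lower quantile `min {x | P[X ≤ x] ≥ α}`. -/
def lowerQuantile {Ω : Type*} [MeasurableSpace Ω] (P : Measure Ω) (X : Ω → ℝ) (α : ℝ) : ℝ :=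
  sInf {x : ℝ | α ≤ P.real {ω | X ω ≤ x}}

/-- Value-at-risk, the upper quantile `max {x | P[X < x] ≤ α}`. -/
def VaR {Ω : Type*} [MeasurableSpace Ω] (P : Measure Ω) (X : Ω → ℝ) (α : ℝ) : ℝ :=
  sSup {x : ℝ | P.real {ω | X ω < x} ≤ α}

/-- Derivative `∂l^κ_α(δ)` of the soft quantile loss. -/
def softQuantileLossDeriv (κ α δ : ℝ) : ℝ :=
  if δ < -κ then (1 - α) * (κ * δ + κ ^ 2 - 1)
  else if δ < 0 then (1 - α) / κ * δ
  else if δ < κ then α / κ * δ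
  else α * (κ * δ - κ ^ 2 + 1)

/-- `∂l^κ_{ε,α}(δ)`: the level is clipped to `[ε, 1 - ε]`. -/
def clippedLossDeriv (ε κ α δ : ℝ) : ℝ :=
  softQuantileLossDeriv κ (max ε (min (1 - ε) α)) δ

/-- A discounted Markov decision process with random rewards: `trans (s, a)` is the joint law of
the reward and the next state after action `a` in state `s`. -/
structure MDP (S A : Type*) [MeasurableSpace S] [MeasurableSpace A] where
  trans : Kernel (S × A) (ℝ × S)
  markov : IsMarkovKernel trans
  γ : ℝ

/-- Histories `(s₀, a₀, r₀, s₁, …, a_{n-1}, r_{n-1}, s_n)`: the initial state together with the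
transitions `(a_k, r_k, s_{k+1})` for `k < n`. -/
abbrev History (S A : Type*) (n : ℕ) : Type _ := S × (Fin n → A × ℝ × S)

/-- The last state `s_n` of a history. -/
def History.last {S A : Type*} : {n : ℕ} → History S A n → S
  | 0, h => h.1
  | n + 1, h => (h.2 (Fin.last n)).2.2

theorem History.measurable_last {S A : Type*} [MeasurableSpace S] [MeasurableSpace A] {n : ℕ} :
    Measurable (History.last : History S A n → S) := by
  cases n with
  | zero => exact measurable_fst
  | succ n =>
    exact measurable_snd.comp (measurable_snd.comp
      ((measurable_pi_apply (Fin.last n)).comp measurable_snd))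

/-- A (possibly randomized) history-dependent policy. -/
structure HistoryPolicy (S A : Type*) [MeasurableSpace S] [MeasurableSpace A] where
  act : (n : ℕ) → Kernel (History S A n) A
  markov : ∀ n, IsMarkovKernel (act n)

attribute [instance] MDP.markov HistoryPolicy.markov

namespace MDP

variable {S A : Type*} [MeasurableSpace S] [MeasurableSpace A]

/-- Law of the next transition `(a_n, r_n, s_{n+1})` given the history up to `s_n`. -/
def stepKernel (M : MDP S A) (π : HistoryPolicy S A) (n : ℕ) :
    Kernel (History S A n) (A × ℝ × S) :=
  (π.act n).compProd (M.trans.comap (fun p : History S A n × A => (p.1.last, p.2))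
    ((History.measurable_last.comp measurable_fst).prodMk measurable_snd))

instance (M : MDP S A) (π : HistoryPolicy S A) (n : ℕ) : IsMarkovKernel (M.stepKernel π n) := by
  unfold stepKernel; infer_instance

/-- The history formed by the initial state `s` and the transitions `0, …, n`. -/
def toHistory (s : S) (n : ℕ) (h : (i : Finset.Iic n) → A × ℝ × S) : History S A (n + 1) :=
  (s, fun i => h ⟨i, Finset.mem_Iic.2 (Nat.lt_succ_iff.1 i.2)⟩)

theorem measurable_toHistory (s : S) (n : ℕ) :
    Measurable (toHistory (A := A) s n) :=
  measurable_const.prodMk (measurable_pi_lambda _ fun _ => measurable_pi_apply _)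

/-- Law of the infinite sequence of transitions `(a_t, r_t, s_{t+1})`, `t = 0, 1, …`, under the
policy `π` from the initial state `s`. -/
def trajLaw (M : MDP S A) (π : HistoryPolicy S A) (s : S) : Measure (ℕ → A × ℝ × S) :=
  Kernel.trajMeasure (X := fun _ => A × ℝ × S) (M.stepKernel π 0 (s, Fin.elim0))
    (fun n => (M.stepKernel π (n + 1)).comap (toHistory s n) (measurable_toHistory s n))

/-- The discounted return `∑ₜ γᵗ rₜ`. -/
def discountedReturn (M : MDP S A) (ω : ℕ → A × ℝ × S) : ℝ :=
  ∑' t : ℕ, M.γ ^ t * (ω t).2.1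

/-- `VaR_α` of the return under the policy `π` from the initial state `s`. -/
def returnVaR (M : MDP S A) (π : HistoryPolicy S A) (s : S) (α : Level) : ℝ :=
  VaR (M.trajLaw π s) M.discountedReturn α

/-- The optimal quantile value function over history-dependent policies. -/
def vStar (M : MDP S A) (s : S) (α : Level) : ℝ :=
  ⨆ π : HistoryPolicy S A, M.returnVaR π s α

/-- Joint law of `((r̃(s,a), s̃'), ũ)` with `ũ` uniform and independent of `(r̃(s,a), s̃')`. -/
def sampleLaw (M : MDP S A) (s : S) (a : A) : Measure ((ℝ × S) × Level) :=
  (M.trans (s, a)).prod uniformLevel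

/-- The random variable `r̃(s,a) + γ v(s̃', ũ)` on the space of samples `((r, s'), u)`. -/
def target (M : MDP S A) (v : S → Level → ℝ) (p : (ℝ × S) × Level) : ℝ :=
  p.1.1 + M.γ * v p.1.2 p.2

/-- The state-only VaR Bellman optimality operator `T*_{ε,κ}` with step size `η`. -/
def bellmanOp (M : MDP S A) (ε κ η : ℝ) (v : S → Level → ℝ) (s : S) (α : Level) : ℝ :=
  v s α + η * ⨆ a : A,
    ∫ p, clippedLossDeriv ε κ α (M.target v p - v s α) ∂(M.sampleLaw s a)

/-- Quantile value functions: jointly measurable and bounded. -/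
def IsValueFunction (v : S → Level → ℝ) : Prop :=
  Measurable (Function.uncurry v) ∧ ∃ C : ℝ, ∀ s α, |v s α| ≤ C

end MDP

end

open MeasureTheory ProbabilityTheory
open scoped ENNReal Topology
open Filter

/-! ### Value iteration for the minimal probability of missing a target. -/

namespace MDP

variable {S A : Type*} [MeasurableSpace S] [MeasurableSpace A]

/-! Quantiles are traded for their inverse, the least probability `G(s,x)` over policies that the
return falls below `x`. After a reward `r` the remaining target is `(x - r) / γ`, so `G` obeys an
expectation Bellman equation on states augmented by the target. Value iteration increases to a fixed
point `minMissProb`. It bounds the miss probability of every policy from below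
(`minMissProb_le_trajLaw`), and for each target a greedy policy attains it
(`exists_policy_trajLaw_le`). Since `G(s,·)` is left-continuous, `x ≤ v*(s,α)` iff `G(s,x) ≤ α`
(`le_vStar_iff`); this gives attainment and measurability, and identifies `G` with `levelCdf vStar`.

At `ε = κ = 0`, `v` is a fixed point of the operator iff `missOp (levelCdf v) s (v s α) = α`
(`isFixedPt_bellmanOp_iff`). The density makes `G(s,·)` right-continuous, so `G(s, v*(s,α)) = α`,
and `v*` is fixed.

For another fixed point `v`, `levelCdf v` is also fixed by `missOp` (`levelCdf_eq_missOp`). Two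
fixed points comparable up to a shift `d` of the target are comparable up to `γ^n d`
(`le_shift_pow`), so continuity forces `levelCdf v = G`. Thus `v(s,α)` and `v*(s,α)` lie in the same
level set of `G(s,·)`, of which `v*(s,α)` is the maximum. Uniqueness of quantiles rules out `v <
v*`. -/

/-- Expected value of `F` at the next state and rescaled target `(x - r) / γ` after action `a`. -/
noncomputable def actionMissProb (M : MDP S A) (F : S → ℝ → ℝ≥0∞) (s : S) (a : A) (x : ℝ) :
    ℝ≥0∞ :=
  ∫⁻ p, F p.2 ((x - p.1) / M.γ) ∂(M.trans (s, a))

/-- Bellman operator for minimizing the probability that the return misses the target `x`. -/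
noncomputable def missOp (M : MDP S A) (F : S → ℝ → ℝ≥0∞) (s : S) (x : ℝ) : ℝ≥0∞ :=
  ⨅ a : A, M.actionMissProb F s a x

/-- Iterates of `missOp` started from the indicator of the targets above `c`. -/
noncomputable def missIter (M : MDP S A) (c : ℝ) : ℕ → S → ℝ → ℝ≥0∞
  | 0 => fun _ x => if c < x then 1 else 0
  | n + 1 => M.missOp (M.missIter c n)

/-- The minimal probability of missing a target, as the limit of the iterates. -/
noncomputable def minMissProb (M : MDP S A) (c : ℝ) (s : S) (x : ℝ) : ℝ≥0∞ :=
  ⨆ n, M.missIter c n s x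

theorem measurable_actionMissProb (M : MDP S A) {F : S → ℝ → ℝ≥0∞}
    (hF : Measurable (Function.uncurry F)) :
    Measurable fun q : (S × A) × ℝ => M.actionMissProb F q.1.1 q.1.2 q.2 := by
  have h : Measurable fun z : ((S × A) × ℝ) × (ℝ × S) => F z.2.2 ((z.1.2 - z.2.1) / M.γ) :=
    hF.comp (f := fun z : ((S × A) × ℝ) × (ℝ × S) => (z.2.2, (z.1.2 - z.2.1) / M.γ))
      (by fun_prop)
  exact h.lintegral_kernel_prod_right' (κ := M.trans.prodMkRight ℝ)

theorem measurable_integrand (M : MDP S A) {F : S → ℝ → ℝ≥0∞}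
    (hF : Measurable (Function.uncurry F)) (x : ℝ) :
    Measurable fun p : ℝ × S => F p.2 ((x - p.1) / M.γ) :=
  hF.comp (f := fun p : ℝ × S => (p.2, (x - p.1) / M.γ)) (by fun_prop)

theorem measurable_missOp [Finite A] (M : MDP S A) {F : S → ℝ → ℝ≥0∞}
    (hF : Measurable (Function.uncurry F)) : Measurable (Function.uncurry (M.missOp F)) := by
  refine Measurable.iInf fun a => ?_
  exact (M.measurable_actionMissProb hF).comp
    (f := fun q : S × ℝ => ((q.1, a), q.2)) (by fun_prop)

theorem missOp_mono (M : MDP S A) {F G : S → ℝ → ℝ≥0∞} (h : ∀ s x, F s x ≤ G s x) (s : S)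
    (x : ℝ) : M.missOp F s x ≤ M.missOp G s x :=
  iInf_mono fun _ => lintegral_mono fun _ => h _ _

theorem monotone_missOp (M : MDP S A) (hγ : 0 < M.γ) {F : S → ℝ → ℝ≥0∞}
    (h : ∀ s, Monotone (F s)) (s : S) : Monotone (M.missOp F s) := fun _ _ hxy =>
  iInf_mono fun _ => lintegral_mono fun _ => h _ (by gcongr)

/-- The source of contraction: the division by `γ` in the remaining target shrinks a shift by the
factor `γ`. -/
theorem missOp_shift (M : MDP S A) (hγ : 0 < M.γ) (F : S → ℝ → ℝ≥0∞) (d : ℝ) (s : S) (x : ℝ) :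
    M.missOp (fun s x => F s (x + d)) s x = M.missOp F s (x + M.γ * d) := by
  have h : ∀ r : ℝ, (x - r) / M.γ + d = (x + M.γ * d - r) / M.γ := fun r => by
    field_simp; ring
  simp only [missOp, actionMissProb, h]

/-- Monotone convergence inside each action; a finite infimum commutes with a monotone supremum. -/
theorem missOp_iSup [Finite A] (M : MDP S A) {F : ℕ → S → ℝ → ℝ≥0∞}
    (hF : ∀ n, Measurable (Function.uncurry (F n))) (hmono : Monotone F) (s : S) (x : ℝ) :
    M.missOp (fun s x => ⨆ n, F n s x) s x = ⨆ n, M.missOp (F n) s x := by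
  have h : ∀ a, M.actionMissProb (fun s x => ⨆ n, F n s x) s a x
      = ⨆ n, M.actionMissProb (F n) s a x := fun a =>
    lintegral_iSup (fun n => M.measurable_integrand (hF n) x) fun _ _ hnm p => hmono hnm _ _
  simp only [missOp, h]
  exact (iSup_iInf_of_monotone (f := fun a n => M.actionMissProb (F n) s a x)
    fun a n m hnm => lintegral_mono fun p => hmono hnm _ _).symm

theorem missOp_le_one [Nonempty A] (M : MDP S A) {F : S → ℝ → ℝ≥0∞} (h : ∀ s x, F s x ≤ 1)
    (s : S) (x : ℝ) : M.missOp F s x ≤ 1 := by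
  refine (iInf_le _ (Classical.arbitrary A)).trans ?_
  exact (lintegral_mono fun _ => h _ _).trans (by simp)

theorem measurable_missIter [Finite A] (M : MDP S A) (c : ℝ) (n : ℕ) :
    Measurable (Function.uncurry (M.missIter c n)) := by
  induction n with
  | zero =>
    exact Measurable.ite (measurableSet_lt measurable_const measurable_snd)
      measurable_const measurable_const
  | succ n ih => exact M.measurable_missOp ih

theorem missIter_le_one [Nonempty A] (M : MDP S A) (c : ℝ) (n : ℕ) (s : S) (x : ℝ) :
    M.missIter c n s x ≤ 1 := by
  induction n generalizing s x with
  | zero => simp only [missIter]; split_ifs <;> simp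
  | succ n ih => exact M.missOp_le_one ih s x

theorem monotone_missIter_apply (M : MDP S A) (hγ : 0 < M.γ) (c : ℝ) (n : ℕ) (s : S) :
    Monotone (M.missIter c n s) := by
  induction n generalizing s with
  | zero =>
    intro x y hxy
    simp only [missIter]
    split_ifs with h₁ h₂
    · exact le_rfl
    · exact absurd (h₁.trans_le hxy) h₂
    · exact zero_le
    · exact le_rfl
  | succ n ih => exact M.monotone_missOp hγ ih s

/-- Left-continuity along increasing sequences. -/
theorem missIter_le_iSup [Finite A] (M : MDP S A) (hγ : 0 < M.γ) (c : ℝ) (n : ℕ) (s : S)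
    {x : ℝ} {u : ℕ → ℝ} (hu : Monotone u) (hux : Tendsto u atTop (𝓝 x)) :
    M.missIter c n s x ≤ ⨆ k, M.missIter c n s (u k) := by
  induction n generalizing s x u with
  | zero =>
    simp only [missIter]
    split_ifs with h
    · obtain ⟨k, hk⟩ := (hux.eventually (lt_mem_nhds h)).exists
      exact le_iSup_of_le k (by rw [if_pos hk])
    · exact zero_le
  | succ n ih =>
    have hstep : ∀ r : ℝ, Monotone (fun k => (u k - r) / M.γ) := fun r i j hij => by
      have := hu hij
      simp only; gcongr
    have h : ∀ a, M.actionMissProb (M.missIter c n) s a x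
        ≤ ⨆ k, M.actionMissProb (M.missIter c n) s a (u k) := fun a => by
      unfold actionMissProb
      rw [← lintegral_iSup (fun k => M.measurable_integrand (M.measurable_missIter c n) (u k))
        fun i j hij p => M.monotone_missIter_apply hγ c n _ (hstep _ hij)]
      exact lintegral_mono fun p => ih p.2 (hstep p.1) ((hux.sub_const _).div_const _)
    refine (iInf_mono h).trans ?_
    exact (iSup_iInf_of_monotone (f := fun a k => M.actionMissProb (M.missIter c n) s a (u k))
      fun a i j hij => lintegral_mono fun p =>
        M.monotone_missIter_apply hγ c n _ (hstep _ hij)).ge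

theorem measurable_minMissProb [Finite A] (M : MDP S A) (c : ℝ) :
    Measurable (Function.uncurry (M.minMissProb c)) :=
  Measurable.iSup fun n => M.measurable_missIter c n

theorem minMissProb_le_one [Nonempty A] (M : MDP S A) (c : ℝ) (s : S) (x : ℝ) :
    M.minMissProb c s x ≤ 1 :=
  iSup_le fun n => M.missIter_le_one c n s x

theorem monotone_minMissProb (M : MDP S A) (hγ : 0 < M.γ) (c : ℝ) (s : S) :
    Monotone (M.minMissProb c s) := fun _ _ hxy =>
  iSup_mono fun n => M.monotone_missIter_apply hγ c n s hxy

/-- Left-continuity passes from the iterates to their supremum because suprema commute. -/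
theorem minMissProb_le_of_forall_lt [Finite A] (M : MDP S A) (hγ : 0 < M.γ) (c : ℝ) (s : S)
    {x : ℝ} {t : ℝ≥0∞} (h : ∀ y < x, M.minMissProb c s y ≤ t) : M.minMissProb c s x ≤ t := by
  obtain ⟨u, hu, hux, hlim⟩ := exists_seq_strictMono_tendsto x
  refine iSup_le fun n => (M.missIter_le_iSup hγ c n s hu.monotone hlim).trans ?_
  exact iSup_le fun k => (le_iSup (fun n => M.missIter c n s (u k)) n).trans (h _ (hux k))

section Bounded

variable {M : MDP S A} {R c : ℝ}

/-- Since `c = γ c + R`, a target above `c` stays above `c` after any reward of size at most `R`, so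
the first step cannot lower the indicator. -/
theorem monotone_missIter (hγ : 0 < M.γ) (hR : ∀ s a, ∀ᵐ p ∂(M.trans (s, a)), |p.1| ≤ R)
    (hc : M.γ * c + R = c) : Monotone (M.missIter c) := by
  refine monotone_nat_of_le_succ fun n => ?_
  induction n with
  | zero =>
    intro s x
    simp only [missIter]
    split_ifs with h
    · refine le_iInf fun a => ?_
      have h1 : ∀ᵐ p ∂(M.trans (s, a)), (1 : ℝ≥0∞) ≤ M.missIter c 0 p.2 ((x - p.1) / M.γ) := by
        filter_upwards [hR s a] with p hp
        have : c < (x - p.1) / M.γ := by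
          rw [lt_div_iff₀ hγ]; linarith [(abs_le.1 hp).2]
        simp [missIter, this]
      refine le_trans ?_ (lintegral_mono_ae h1)
      simp
    · exact zero_le
  | succ n ih => exact fun s x => M.missOp_mono ih s x

theorem missOp_minMissProb [Finite A] (hγ : 0 < M.γ)
    (hR : ∀ s a, ∀ᵐ p ∂(M.trans (s, a)), |p.1| ≤ R) (hc : M.γ * c + R = c) (s : S) (x : ℝ) :
    M.missOp (M.minMissProb c) s x = M.minMissProb c s x := by
  have hm := monotone_missIter hγ hR hc
  have h := M.missOp_iSup (M.measurable_missIter c) hm s x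
  refine h.trans (le_antisymm (iSup_le fun n => le_iSup (fun n => M.missIter c n s x) (n + 1))
    (iSup_le fun n => ?_))
  exact le_iSup_of_le n (hm n.le_succ s x)

theorem minMissProb_eq_one [Nonempty A] {s : S} {x : ℝ} (hx : c < x) :
    M.minMissProb c s x = 1 := by
  refine le_antisymm (M.minMissProb_le_one c s x) (le_iSup_of_le 0 ?_)
  simp [missIter, hx]

theorem minMissProb_eq_zero [Nonempty A] (hγ : 0 < M.γ)
    (hR : ∀ s a, ∀ᵐ p ∂(M.trans (s, a)), |p.1| ≤ R) (hc : M.γ * c + R = c) (hc0 : 0 ≤ c)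
    {s : S} {x : ℝ} (hx : x ≤ -c) : M.minMissProb c s x = 0 := by
  refine le_antisymm (iSup_le fun n => ?_) zero_le
  induction n generalizing s x with
  | zero => simp [missIter, show x ≤ c by linarith]
  | succ n ih =>
    refine (iInf_le _ (Classical.arbitrary A)).trans ?_
    refine (lintegral_mono_ae (g := fun _ => 0) ?_).trans (by simp)
    filter_upwards [hR s (Classical.arbitrary A)] with p hp
    refine ih ?_
    rw [div_le_iff₀ hγ]; linarith [(abs_le.1 hp).1]

end Bounded

end MDP

/-! ### Measurable selection and the trajectory law. -/

/-- A measurable selection of a minimizer over a finite set. -/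
theorem exists_measurable_argmin {X A : Type*} [MeasurableSpace X] [MeasurableSpace A]
    [Finite A] [Nonempty A] {f : A → X → ℝ≥0∞} (hf : ∀ a, Measurable (f a)) :
    ∃ φ : X → A, Measurable φ ∧ ∀ x, f (φ x) x = ⨅ a, f a x := by
  classical
  have := Fintype.ofFinite A
  suffices h : ∀ t : Finset A, t.Nonempty → ∃ φ : X → A, Measurable φ ∧
      Measurable (fun x => f (φ x) x) ∧ ∀ x, ∀ a ∈ t, f (φ x) x ≤ f a x by
    obtain ⟨φ, hφ, -, h⟩ := h Finset.univ Finset.univ_nonempty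
    exact ⟨φ, hφ, fun x => le_antisymm (le_iInf fun a => h x a (Finset.mem_univ a))
      (iInf_le _ _)⟩
  intro t ht
  induction ht using Finset.Nonempty.cons_induction with
  | singleton a => exact ⟨fun _ => a, measurable_const, hf a, by simp⟩
  | cons a t ha ht ih =>
    obtain ⟨φ, hφ, hfφ, h⟩ := ih
    have hs : MeasurableSet {x | f a x ≤ f (φ x) x} := measurableSet_le (hf a) hfφ
    refine ⟨fun x => if f a x ≤ f (φ x) x then a else φ x,
      Measurable.ite hs measurable_const hφ, ?_, fun x b hb => ?_⟩
    · have : (fun x => f (if f a x ≤ f (φ x) x then a else φ x) x)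
          = fun x => min (f a x) (f (φ x) x) := by
        funext x
        split_ifs with h'
        · exact (min_eq_left h').symm
        · exact (min_eq_right (le_of_not_ge h')).symm
      rw [this]
      exact (hf a).min hfφ
    · beta_reduce
      rcases Finset.mem_cons.1 hb with rfl | hb
      · split_ifs with h'
        · exact le_rfl
        · exact le_of_not_ge h'
      · split_ifs with h'
        · exact h'.trans (h x b hb)
        · exact h x b hb

namespace MDP

variable {S A : Type*} [MeasurableSpace S] [MeasurableSpace A]

/-- The history of the first `n` transitions of a trajectory. -/
def historyUpTo (s : S) (n : ℕ) (ω : ℕ → A × ℝ × S) : History S A n := (s, fun i => ω i)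

theorem measurable_historyUpTo (s : S) (n : ℕ) : Measurable (historyUpTo (A := A) s n) :=
  measurable_const.prodMk (measurable_pi_lambda _ fun _ => measurable_pi_apply _)

instance (M : MDP S A) (π : HistoryPolicy S A) (s : S) : IsProbabilityMeasure (M.trajLaw π s) := by
  unfold trajLaw; infer_instance

theorem map_zero_trajLaw (M : MDP S A) (π : HistoryPolicy S A) (s : S) :
    (M.trajLaw π s).map (fun ω => ω 0) = M.stepKernel π 0 (s, Fin.elim0) := by
  have hf : (fun ω : ℕ → A × ℝ × S => ω 0)
      = (fun y => y ⟨0, Finset.mem_Iic.2 le_rfl⟩) ∘ Preorder.frestrictLe 0 := rfl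
  rw [hf, ← Measure.map_map (by fun_prop) (by fun_prop), trajLaw, Kernel.trajMeasure,
    Measure.map_comp _ _ (by fun_prop), Kernel.traj_map_frestrictLe, Kernel.partialTraj_self,
    Measure.id_comp, Measure.map_map (by fun_prop) (by fun_prop)]
  exact Measure.map_id

/-- Disintegration of the trajectory law at time `n`. Time `0` is separate because `trajMeasure`
treats the first transition as its initial law. -/
theorem lintegral_trajLaw_step (M : MDP S A) (π : HistoryPolicy S A) (s : S) (n : ℕ)
    {f : History S A n × (A × ℝ × S) → ℝ≥0∞} (hf : Measurable f) :
    ∫⁻ ω, f (historyUpTo s n ω, ω n) ∂(M.trajLaw π s)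
      = ∫⁻ ω, ∫⁻ y, f (historyUpTo s n ω, y) ∂(M.stepKernel π n (historyUpTo s n ω))
          ∂(M.trajLaw π s) := by
  cases n with
  | zero =>
    have h0 : ∀ ω : ℕ → A × ℝ × S, historyUpTo s 0 ω = (s, Fin.elim0) := fun ω =>
      Prod.ext rfl (Subsingleton.elim _ _)
    simp only [h0, lintegral_const, measure_univ, mul_one]
    rw [← M.map_zero_trajLaw π s, lintegral_map (by fun_prop) (by fun_prop)]
  | succ n =>
    have hκ := Kernel.map_frestrictLe_trajMeasure_compProd_eq_map_trajMeasure
      (X := fun _ => A × ℝ × S) (μ₀ := M.stepKernel π 0 (s, Fin.elim0))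
      (κ := fun n => (M.stepKernel π (n + 1)).comap (toHistory s n) (measurable_toHistory s n))
      (a := n)
    have hg : Measurable fun z : ((i : Finset.Iic n) → A × ℝ × S) × (A × ℝ × S) =>
        f (toHistory s n z.1, z.2) :=
      hf.comp (((measurable_toHistory s n).comp measurable_fst).prodMk measurable_snd)
    have h := congrArg (fun μ => lintegral μ fun z => f (toHistory s n z.1, z.2)) hκ
    beta_reduce at h
    rw [Measure.lintegral_compProd hg, lintegral_map hg.lintegral_kernel_prod_right' (by fun_prop),
      lintegral_map hg (by fun_prop)] at h
    exact h.symm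

theorem lintegral_stepKernel (M : MDP S A) (π : HistoryPolicy S A) (n : ℕ) (h : History S A n)
    {g : A × ℝ × S → ℝ≥0∞} (hg : Measurable g) :
    ∫⁻ y, g y ∂(M.stepKernel π n h)
      = ∫⁻ a, ∫⁻ p, g (a, p) ∂(M.trans (h.last, a)) ∂(π.act n h) := by
  rw [stepKernel, Kernel.lintegral_compProd _ _ _ hg]
  rfl

theorem ae_abs_reward_le {M : MDP S A} {R : ℝ}
    (hR : ∀ s a, ∀ᵐ p ∂(M.trans (s, a)), |p.1| ≤ R) (π : HistoryPolicy S A) (s : S) :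
    ∀ᵐ ω ∂(M.trajLaw π s), ∀ t, |(ω t).2.1| ≤ R := by
  refine ae_all_iff.2 fun t => ?_
  have hm : MeasurableSet {y : A × ℝ × S | R < |y.2.1|} :=
    measurableSet_lt measurable_const (by fun_prop)
  have h := M.lintegral_trajLaw_step π s t
    (f := fun z => {y : A × ℝ × S | R < |y.2.1|}.indicator 1 z.2)
    ((measurable_one.indicator hm).comp measurable_snd)
  simp only [M.lintegral_stepKernel π t _ (measurable_one.indicator hm)] at h
  have hz : ∀ s a, ∫⁻ p, {y : A × ℝ × S | R < |y.2.1|}.indicator 1 (a, p) ∂(M.trans (s, a))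
      = (0 : ℝ≥0∞) := fun s a => by
    refine (lintegral_eq_zero_iff
      ((measurable_one.indicator hm).comp measurable_prodMk_left)).2 ?_
    filter_upwards [hR s a] with p hp
    simp [not_lt.2 hp]
  simp only [hz, lintegral_zero] at h
  have h' := (lintegral_eq_zero_iff
    ((measurable_one.indicator hm).comp (measurable_pi_apply t))).1 h
  filter_upwards [h'] with ω hω
  by_contra hcon
  simp [not_le.1 hcon] at hω

/-! ### Miss probabilities along trajectories. -/

/-- The target that remains, in units of time `n`, after the rewards of the history `h`. -/
noncomputable def residualTarget (M : MDP S A) (x : ℝ) (n : ℕ) (h : History S A n) : ℝ :=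
  (x - ∑ i : Fin n, M.γ ^ (i : ℕ) * (h.2 i).2.1) / M.γ ^ n

theorem measurable_residualTarget (M : MDP S A) (x : ℝ) (n : ℕ) :
    Measurable (M.residualTarget x n) := by
  unfold residualTarget; fun_prop

theorem residualTarget_succ (M : MDP S A) (x : ℝ) (s : S) (n : ℕ)
    (ω : ℕ → A × ℝ × S) (hγ : 0 < M.γ) :
    M.residualTarget x (n + 1) (historyUpTo s (n + 1) ω)
      = (M.residualTarget x n (historyUpTo s n ω) - (ω n).2.1) / M.γ := by
  simp only [residualTarget, historyUpTo, Fin.sum_univ_castSucc, Fin.val_castSucc, Fin.val_last]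
  field_simp
  ring

/-- `F` at the current state and remaining target after `n` transitions. -/
noncomputable def missAlong (M : MDP S A) (F : S → ℝ → ℝ≥0∞) (x : ℝ) (s : S) (n : ℕ)
    (ω : ℕ → A × ℝ × S) : ℝ≥0∞ :=
  F (historyUpTo s n ω).last (M.residualTarget x n (historyUpTo s n ω))

theorem measurable_missAlong (M : MDP S A) {F : S → ℝ → ℝ≥0∞}
    (hF : Measurable (Function.uncurry F)) (x : ℝ) (s : S) (n : ℕ) :
    Measurable (M.missAlong F x s n) :=
  hF.comp ((History.measurable_last.prodMk (M.measurable_residualTarget x n)).comp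
    (measurable_historyUpTo s n))

theorem lintegral_missAlong_zero (M : MDP S A) (π : HistoryPolicy S A) (F : S → ℝ → ℝ≥0∞)
    (x : ℝ) (s : S) : ∫⁻ ω, M.missAlong F x s 0 ω ∂(M.trajLaw π s) = F s x := by
  simp [missAlong, residualTarget, historyUpTo, History.last]

theorem lintegral_missAlong_succ (M : MDP S A) (hγ : 0 < M.γ) (π : HistoryPolicy S A)
    {F : S → ℝ → ℝ≥0∞} (hF : Measurable (Function.uncurry F)) (x : ℝ) (s : S) (n : ℕ) :
    ∫⁻ ω, M.missAlong F x s (n + 1) ω ∂(M.trajLaw π s)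
      = ∫⁻ ω, ∫⁻ a, M.actionMissProb F (historyUpTo s n ω).last a
          (M.residualTarget x n (historyUpTo s n ω)) ∂(π.act n (historyUpTo s n ω))
          ∂(M.trajLaw π s) := by
  have hf : Measurable fun z : History S A n × (A × ℝ × S) =>
      F z.2.2.2 ((M.residualTarget x n z.1 - z.2.2.1) / M.γ) :=
    hF.comp (f := fun z : History S A n × (A × ℝ × S) =>
      (z.2.2.2, (M.residualTarget x n z.1 - z.2.2.1) / M.γ)) (by
        have := M.measurable_residualTarget (S := S) (A := A) x n
        fun_prop)
  have h := M.lintegral_trajLaw_step π s n hf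
  refine Eq.trans (lintegral_congr fun ω => ?_) (h.trans (lintegral_congr fun ω => ?_))
  · simp only [missAlong, M.residualTarget_succ x s n ω hγ]
    rfl
  · exact M.lintegral_stepKernel π n _ (hf.comp measurable_prodMk_left)

/-- Whatever randomization the policy uses, the average over actions is at least the minimum. -/
theorem lintegral_missAlong_missOp_le (M : MDP S A) (hγ : 0 < M.γ) (π : HistoryPolicy S A)
    {F : S → ℝ → ℝ≥0∞} (hF : Measurable (Function.uncurry F)) (x : ℝ) (s : S) (n : ℕ) :
    ∫⁻ ω, M.missAlong (M.missOp F) x s n ω ∂(M.trajLaw π s)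
      ≤ ∫⁻ ω, M.missAlong F x s (n + 1) ω ∂(M.trajLaw π s) := by
  rw [M.lintegral_missAlong_succ hγ π hF]
  refine lintegral_mono fun ω => ?_
  have h : ∫⁻ _, M.missAlong (M.missOp F) x s n ω ∂(π.act n (historyUpTo s n ω))
      = M.missAlong (M.missOp F) x s n ω := by simp
  rw [← h]
  exact lintegral_mono fun a => iInf_le _ a

theorem missIter_add_le (M : MDP S A) [Finite A] (hγ : 0 < M.γ) (π : HistoryPolicy S A)
    (c x : ℝ) (s : S) (n k : ℕ) :
    M.missIter c (k + n) s x
      ≤ ∫⁻ ω, M.missAlong (M.missIter c k) x s n ω ∂(M.trajLaw π s) := by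
  induction n generalizing k with
  | zero => rw [lintegral_missAlong_zero]; rfl
  | succ n ih =>
    refine le_trans ?_ (M.lintegral_missAlong_missOp_le hγ π (M.measurable_missIter c k) x s n)
    rw [show k + (n + 1) = k + 1 + n by ring]
    exact ih (k + 1)

/-- Some policy makes `missAlong` of a fixed point of `missOp` constant in mean. -/
theorem exists_policy_lintegral_missAlong (M : MDP S A) [Finite A] [Nonempty A]
    [MeasurableSingletonClass A] (hγ : 0 < M.γ) {F : S → ℝ → ℝ≥0∞}
    (hF : Measurable (Function.uncurry F)) (hfix : ∀ s x, M.missOp F s x = F s x) (x : ℝ) :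
    ∃ π : HistoryPolicy S A, ∀ s n,
      ∫⁻ ω, M.missAlong F x s n ω ∂(M.trajLaw π s) = F s x := by
  have hm : ∀ a, Measurable fun q : S × ℝ => M.actionMissProb F q.1 a q.2 := fun a =>
    (M.measurable_actionMissProb hF).comp (f := fun q : S × ℝ => ((q.1, a), q.2)) (by fun_prop)
  obtain ⟨φ, hφ, hmin⟩ := exists_measurable_argmin hm
  have hψ : ∀ n, Measurable fun h : History S A n => φ (h.last, M.residualTarget x n h) :=
    fun n => hφ.comp (History.measurable_last.prodMk (M.measurable_residualTarget x n))
  -- Greedy in the augmented state: the action depends on the history only through the current state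
  -- and the residual target.
  let π : HistoryPolicy S A :=
    ⟨fun n => Kernel.deterministic _ (hψ n), fun n => inferInstance⟩
  refine ⟨π, fun s n => ?_⟩
  induction n with
  | zero => exact M.lintegral_missAlong_zero π F x s
  | succ n ih =>
    rw [← ih, M.lintegral_missAlong_succ hγ π hF]
    refine lintegral_congr fun ω => ?_
    simp only [π, Kernel.deterministic_apply, lintegral_dirac]
    exact (hmin (_, _)).trans (hfix _ _)

section Bounded

variable {M : MDP S A} {R c : ℝ}

theorem hasSum_discountedReturn (hγ : 0 < M.γ) (hγ1 : M.γ < 1) {ω : ℕ → A × ℝ × S}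
    (hω : ∀ t, |(ω t).2.1| ≤ R) :
    HasSum (fun t => M.γ ^ t * (ω t).2.1) (M.discountedReturn ω) := by
  refine Summable.hasSum (Summable.of_norm_bounded (g := fun t => M.γ ^ t * R)
    ((summable_geometric_of_lt_one hγ.le hγ1).mul_right R) fun t => ?_)
  rw [Real.norm_eq_abs, abs_mul, abs_of_pos (pow_pos hγ t)]
  exact mul_le_mul_of_nonneg_left (hω t) (pow_pos hγ t).le

/-- The tail after time `n` is worth at most `γ^n c`; the right-hand side therefore decreases in `n`
to the return. -/
theorem discountedReturn_le (hγ : 0 < M.γ) (hγ1 : M.γ < 1) (hc : M.γ * c + R = c)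
    {ω : ℕ → A × ℝ × S} (hω : ∀ t, |(ω t).2.1| ≤ R) (n : ℕ) :
    M.discountedReturn ω ≤ ∑ i ∈ Finset.range n, M.γ ^ i * (ω i).2.1 + M.γ ^ n * c := by
  have hs := hasSum_discountedReturn hγ hγ1 hω
  have hanti : Antitone fun n =>
      ∑ i ∈ Finset.range n, M.γ ^ i * (ω i).2.1 + M.γ ^ n * c := by
    refine antitone_nat_of_succ_le fun n => ?_
    have h := mul_le_mul_of_nonneg_left (abs_le.1 (hω n)).2 (pow_pos hγ n).le
    have hc' : M.γ ^ n * (M.γ * c + R) = M.γ ^ n * c := by rw [hc]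
    rw [Finset.sum_range_succ, pow_succ]
    linarith
  have hlim := hs.tendsto_sum_nat.add
    ((tendsto_pow_atTop_nhds_zero_of_lt_one hγ.le hγ1).mul_const c)
  rw [zero_mul, add_zero] at hlim
  exact hanti.le_of_tendsto hlim n

theorem missAlong_missIter_zero (hγ : 0 < M.γ) (x : ℝ) (s : S) (n : ℕ)
    (ω : ℕ → A × ℝ × S) :
    M.missAlong (M.missIter c 0) x s n ω
      = if ∑ i ∈ Finset.range n, M.γ ^ i * (ω i).2.1 + M.γ ^ n * c < x then 1 else 0 := by
  have hγn := pow_pos hγ n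
  have hres : M.residualTarget x n (historyUpTo s n ω)
      = (x - ∑ i ∈ Finset.range n, M.γ ^ i * (ω i).2.1) / M.γ ^ n := by
    rw [← Fin.sum_univ_eq_sum_range (fun i => M.γ ^ i * (ω i).2.1) n]
    rfl
  refine if_congr ?_ rfl rfl
  rw [hres, lt_div_iff₀ hγn]
  constructor <;> intro h <;> linarith

theorem measurable_discountedReturn (M : MDP S A) : Measurable M.discountedReturn := by
  unfold discountedReturn
  fun_prop

theorem minMissProb_le_trajLaw [Finite A] (hγ : 0 < M.γ) (hγ1 : M.γ < 1)
    (hR : ∀ s a, ∀ᵐ p ∂(M.trans (s, a)), |p.1| ≤ R) (hc : M.γ * c + R = c)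
    (π : HistoryPolicy S A) (s : S) (x : ℝ) :
    M.minMissProb c s x ≤ M.trajLaw π s {ω | M.discountedReturn ω < x} := by
  refine iSup_le fun n => ?_
  have h := M.missIter_add_le hγ π c x s n 0
  rw [zero_add] at h
  refine h.trans ?_
  rw [← lintegral_indicator_one (measurableSet_lt M.measurable_discountedReturn measurable_const)]
  refine lintegral_mono_ae ?_
  filter_upwards [ae_abs_reward_le hR π s] with ω hω
  rw [missAlong_missIter_zero hγ]
  split_ifs with h
  · have : M.discountedReturn ω < x := (discountedReturn_le hγ hγ1 hc hω n).trans_lt h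
    simp [this]
  · exact zero_le

theorem exists_policy_trajLaw_le [Finite A] [Nonempty A] [MeasurableSingletonClass A]
    (hγ : 0 < M.γ) (hγ1 : M.γ < 1)
    (hR : ∀ s a, ∀ᵐ p ∂(M.trans (s, a)), |p.1| ≤ R) (hc : M.γ * c + R = c) (x : ℝ) :
    ∃ π : HistoryPolicy S A, ∀ s,
      M.trajLaw π s {ω | M.discountedReturn ω < x} ≤ M.minMissProb c s x := by
  obtain ⟨π, hπ⟩ := M.exists_policy_lintegral_missAlong hγ (M.measurable_minMissProb c)
    (missOp_minMissProb hγ hR hc) x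
  refine ⟨π, fun s => ?_⟩
  have hmeas := fun n => M.measurable_missAlong (M.measurable_missIter c 0) x s n
  calc M.trajLaw π s {ω | M.discountedReturn ω < x}
      = ∫⁻ ω, {ω | M.discountedReturn ω < x}.indicator 1 ω ∂(M.trajLaw π s) :=
        (lintegral_indicator_one
          (measurableSet_lt M.measurable_discountedReturn measurable_const)).symm
    -- The partial sum plus `γ^n c` tends to the return, so it is eventually below `x` whenever the
    -- return is. Fatou then moves the limit outside the integral.
    _ ≤ ∫⁻ ω, liminf (fun n => M.missAlong (M.missIter c 0) x s n ω) atTop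
          ∂(M.trajLaw π s) := by
        refine lintegral_mono_ae ?_
        filter_upwards [ae_abs_reward_le hR π s] with ω hω
        by_cases hx : M.discountedReturn ω < x
        · have hlim := (hasSum_discountedReturn hγ hγ1 hω).tendsto_sum_nat.add
            ((tendsto_pow_atTop_nhds_zero_of_lt_one hγ.le hγ1).mul_const c)
          rw [zero_mul, add_zero] at hlim
          have hev : ∀ᶠ n in atTop,
              (1 : ℝ≥0∞) ≤ M.missAlong (M.missIter c 0) x s n ω := by
            filter_upwards [hlim.eventually (gt_mem_nhds hx)] with n hn
            rw [missAlong_missIter_zero hγ, if_pos hn]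
          simpa [hx] using le_liminf_of_le (by isBoundedDefault) hev
        · simp [hx]
    _ ≤ liminf (fun n => ∫⁻ ω, M.missAlong (M.missIter c 0) x s n ω ∂(M.trajLaw π s)) atTop :=
        lintegral_liminf_le hmeas
    _ ≤ liminf (fun _ : ℕ => M.minMissProb c s x) atTop := by
        refine liminf_le_liminf (Eventually.of_forall fun n => ?_) (by isBoundedDefault)
          (by isBoundedDefault)
        rw [← hπ s n]
        exact lintegral_mono fun ω => le_iSup (fun k => M.missIter c k _ _) 0
    _ = M.minMissProb c s x := liminf_const _

end Bounded

end MDP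

/-! ### Quantiles and uniform levels. -/

theorem real_le_iff_le_ofReal {Ω : Type*} [MeasurableSpace Ω] {P : Measure Ω} [IsFiniteMeasure P]
    {t : Set Ω} {α : ℝ} (hα : 0 ≤ α) : P.real t ≤ α ↔ P t ≤ ENNReal.ofReal α :=
  (ENNReal.le_ofReal_iff_toReal_le (measure_ne_top P t) hα).symm

section Quantiles

variable {Ω : Type*} [MeasurableSpace Ω] {P : Measure Ω} [IsProbabilityMeasure P] {X : Ω → ℝ}

theorem cdf_map_eq_real (hX : Measurable X) (x : ℝ) : cdf (P.map X) x = P.real {ω | X ω ≤ x} := by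
  have := Measure.isProbabilityMeasure_map (μ := P) hX.aemeasurable
  rw [cdf_eq_real, map_measureReal_apply hX measurableSet_Iic]
  rfl

theorem lowerQuantile_le (hX : Measurable X) {α x : ℝ} (hα : 0 < α)
    (hx : α ≤ P.real {ω | X ω ≤ x}) : lowerQuantile P X α ≤ x := by
  refine csInf_le ?_ hx
  obtain ⟨b, hb⟩ := ((tendsto_cdf_atBot (P.map X)).eventually (gt_mem_nhds hα)).exists
  rw [cdf_map_eq_real hX] at hb
  refine ⟨b, fun y hy => le_of_not_gt fun hyb => ?_⟩
  exact absurd ((le_trans hy (measureReal_mono fun ω (hω : X ω ≤ y) => hω.trans hyb.le)).trans_lt hb)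
    (lt_irrefl _)

theorem le_VaR (hX : Measurable X) {α x : ℝ} (hα : α < 1)
    (hx : P.real {ω | X ω < x} ≤ α) : x ≤ VaR P X α := by
  refine le_csSup ?_ hx
  obtain ⟨b, hb⟩ := ((tendsto_cdf_atTop (P.map X)).eventually (lt_mem_nhds hα)).exists
  rw [cdf_map_eq_real hX] at hb
  refine ⟨b, fun y hy => le_of_not_gt fun hyb => ?_⟩
  exact absurd (hb.trans_le ((measureReal_mono fun ω (hω : X ω ≤ b) => hω.trans_lt hyb).trans hy))
    (lt_irrefl _)

theorem VaR_le (hX : Measurable X) {α y : ℝ} (hα : 0 < α)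
    (h : ∀ x, P.real {ω | X ω < x} ≤ α → x ≤ y) : VaR P X α ≤ y := by
  refine csSup_le ?_ h
  obtain ⟨b, hb⟩ := ((tendsto_cdf_atBot (P.map X)).eventually (gt_mem_nhds hα)).exists
  rw [cdf_map_eq_real hX] at hb
  exact ⟨b, (measureReal_mono fun ω (hω : X ω < b) => hω.le).trans hb.le⟩

end Quantiles

theorem uniformLevel_apply (p : ℝ → Prop) :
    uniformLevel {u | p u} = volume {x : ℝ | p x ∧ 0 < x ∧ x < 1} := by
  rw [uniformLevel, comap_subtype_coe_apply measurableSet_Ioo]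
  congr 1
  ext x
  constructor
  · rintro ⟨u, hu, rfl⟩
    exact ⟨hu, u.2⟩
  · rintro ⟨hx, h⟩
    exact ⟨⟨x, h⟩, hx, rfl⟩

instance : IsProbabilityMeasure uniformLevel := ⟨by
  have h := uniformLevel_apply fun _ => True
  simp only [Set.ofPred_true, true_and] at h
  rw [h]
  exact Real.volume_Ioo.trans (by simp)⟩

theorem uniformLevel_lt {g : ℝ≥0∞} (hg : g ≤ 1) :
    uniformLevel {u | ENNReal.ofReal u < g} = g := by
  have hgt : g ≠ ∞ := ne_top_of_le_ne_top ENNReal.one_ne_top hg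
  have hg1 : g.toReal ≤ 1 := ENNReal.toReal_le_of_le_ofReal zero_le_one (by simpa using hg)
  rw [uniformLevel_apply fun x => ENNReal.ofReal x < g]
  have : {x : ℝ | ENNReal.ofReal x < g ∧ 0 < x ∧ x < 1} = Set.Ioo 0 g.toReal := by
    ext x
    constructor
    · rintro ⟨h, h0, -⟩
      exact ⟨h0, (ENNReal.ofReal_lt_iff_lt_toReal h0.le hgt).1 h⟩
    · rintro ⟨h0, h⟩
      exact ⟨(ENNReal.ofReal_lt_iff_lt_toReal h0.le hgt).2 h, h0, h.trans_le hg1⟩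
  rw [this, Real.volume_Ioo, sub_zero, ENNReal.ofReal_toReal hgt]

theorem uniformLevel_le {g : ℝ≥0∞} (hg : g ≤ 1) :
    uniformLevel {u | ENNReal.ofReal u ≤ g} ≤ g := by
  have hgt : g ≠ ∞ := ne_top_of_le_ne_top ENNReal.one_ne_top hg
  rw [uniformLevel_apply fun x => ENNReal.ofReal x ≤ g]
  calc volume {x : ℝ | ENNReal.ofReal x ≤ g ∧ 0 < x ∧ x < 1}
      ≤ volume (Set.Ioc 0 g.toReal) := measure_mono fun x hx =>
        ⟨hx.2.1, (ENNReal.ofReal_le_iff_le_toReal hgt).1 hx.1⟩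
    _ = g := by rw [Real.volume_Ioc, sub_zero, ENNReal.ofReal_toReal hgt]

/-! ### The Bellman equation as an equation for miss probabilities. -/

namespace MDP

variable {S A : Type*} [MeasurableSpace S] [MeasurableSpace A]

instance (M : MDP S A) (s : S) (a : A) : IsProbabilityMeasure (M.sampleLaw s a) := by
  unfold sampleLaw; infer_instance

/-- Probability that `v s u < x` for a uniformly distributed level `u`. -/
noncomputable def levelCdf {S : Type*} (v : S → Level → ℝ) (s : S) (x : ℝ) : ℝ≥0∞ :=
  uniformLevel {u | v s u < x}

theorem levelCdf_le_one {S : Type*} (v : S → Level → ℝ) (s : S) (x : ℝ) :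
    levelCdf v s x ≤ 1 := prob_le_one

theorem monotone_levelCdf {S : Type*} (v : S → Level → ℝ) (s : S) : Monotone (levelCdf v s) :=
  fun _ _ hxy => measure_mono fun _ hu => lt_of_lt_of_le hu hxy

theorem measurable_target (M : MDP S A) {v : S → Level → ℝ}
    (hv : Measurable (Function.uncurry v)) : Measurable (M.target v) := by
  have : Measurable fun p : (ℝ × S) × Level => v p.1.2 p.2 :=
    hv.comp (f := fun p : (ℝ × S) × Level => (p.1.2, p.2)) (by fun_prop)
  unfold target
  fun_prop

theorem sampleLaw_target_lt (M : MDP S A) (hγ : 0 < M.γ) {v : S → Level → ℝ}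
    (hv : Measurable (Function.uncurry v)) (s : S) (a : A) (x : ℝ) :
    M.sampleLaw s a {p | M.target v p < x} = M.actionMissProb (levelCdf v) s a x := by
  rw [sampleLaw, Measure.prod_apply (measurableSet_lt (M.measurable_target hv) measurable_const)]
  refine lintegral_congr fun p => congrArg uniformLevel ?_
  ext u
  simp only [target, Set.mem_preimage, Set.mem_ofPred_eq, lt_div_iff₀ hγ]
  constructor <;> intro h <;> linarith

/-- At `κ = 0` the two middle branches are unreachable, so the division by zero never matters. -/
theorem clippedLossDeriv_zero_zero (α : Level) (δ : ℝ) :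
    clippedLossDeriv 0 0 α δ = α - if δ < 0 then 1 else 0 := by
  have h : max 0 (min (1 - 0) (α : ℝ)) = α := by
    rw [sub_zero, min_eq_right α.2.2.le, max_eq_right α.2.1.le]
  simp only [clippedLossDeriv, h, softQuantileLossDeriv, neg_zero]
  split_ifs <;> ring

theorem integral_clippedLossDeriv (M : MDP S A) (hγ : 0 < M.γ) {v : S → Level → ℝ}
    (hv : Measurable (Function.uncurry v)) (s : S) (a : A) (α : Level) (x : ℝ) :
    ∫ p, clippedLossDeriv 0 0 α (M.target v p - x) ∂(M.sampleLaw s a)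
      = α - (M.actionMissProb (levelCdf v) s a x).toReal := by
  have hm : MeasurableSet {p | M.target v p < x} :=
    measurableSet_lt (M.measurable_target hv) measurable_const
  have h : ∀ p, clippedLossDeriv 0 0 α (M.target v p - x)
      = α - {p | M.target v p < x}.indicator 1 p := fun p => by
    simp [clippedLossDeriv_zero_zero, Set.indicator_apply]
  have hint : Integrable ({p | M.target v p < x}.indicator (1 : (ℝ × S) × Level → ℝ))
      (M.sampleLaw s a) := (integrable_const (1 : ℝ)).indicator hm
  simp only [h]
  rw [integral_sub (integrable_const _) hint, integral_indicator_one hm, integral_const,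
    probReal_univ, one_smul, measureReal_def,
    M.sampleLaw_target_lt hγ hv]

theorem exists_actionMissProb_eq_missOp [Finite A] [Nonempty A] (M : MDP S A)
    (F : S → ℝ → ℝ≥0∞) (s : S) (x : ℝ) : ∃ a, M.actionMissProb F s a x = M.missOp F s x :=
  exists_eq_ciInf_of_finite

theorem actionMissProb_le_one (M : MDP S A) {F : S → ℝ → ℝ≥0∞} (h : ∀ s x, F s x ≤ 1)
    (s : S) (a : A) (x : ℝ) : M.actionMissProb F s a x ≤ 1 :=
  (lintegral_mono fun _ => h _ _).trans (by simp)

/-- The expected loss derivative of an action is `α` minus its miss probability, so the maximum over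
actions is `α` minus `missOp`, and `η ≠ 0` cancels. -/
theorem isFixedPt_bellmanOp_iff [Finite A] [Nonempty A] (M : MDP S A) (hγ : 0 < M.γ) {η : ℝ}
    (hη : 0 < η) {v : S → Level → ℝ} (hv : Measurable (Function.uncurry v)) :
    Function.IsFixedPt (M.bellmanOp 0 0 η) v ↔
      ∀ s (α : Level), M.missOp (levelCdf v) s (v s α) = ENNReal.ofReal α := by
  have key : ∀ s (α : Level), M.bellmanOp 0 0 η v s α = v s α ↔
      M.missOp (levelCdf v) s (v s α) = ENNReal.ofReal α := fun s α => by
    have htop : ∀ a, M.actionMissProb (levelCdf v) s a (v s α) ≠ ∞ := fun a =>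
      ne_top_of_le_ne_top ENNReal.one_ne_top (M.actionMissProb_le_one (levelCdf_le_one v) s a _)
    obtain ⟨a, ha⟩ := M.exists_actionMissProb_eq_missOp (levelCdf v) s (v s α)
    have hsup : (⨆ a, ∫ p, clippedLossDeriv 0 0 α (M.target v p - v s α) ∂(M.sampleLaw s a))
        = α - (M.missOp (levelCdf v) s (v s α)).toReal := by
      simp only [M.integral_clippedLossDeriv hγ hv]
      refine IsGreatest.csSup_eq ⟨⟨a, by rw [← ha]⟩, ?_⟩
      rintro _ ⟨b, rfl⟩
      exact sub_le_sub_left (ENNReal.toReal_mono (htop b) (iInf_le _ b)) _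
    rw [bellmanOp, hsup, add_eq_left, mul_eq_zero, or_iff_right hη.ne', sub_eq_zero, ← ha]
    constructor
    · intro h
      rw [h, ENNReal.ofReal_toReal (htop a)]
    · intro h
      rw [h, ENNReal.toReal_ofReal α.2.1.le]
  constructor
  · exact fun h s α => (key s α).1 (congrFun (congrFun h s) α)
  · exact fun h => funext fun s => funext fun α => (key s α).2 (h s α)

/-- By monotonicity, `u < missOp (levelCdf v) s x` implies `v s u < x`, which in turn implies `u ≤
missOp (levelCdf v) s x`. Under the uniform law both bounds have the same probability. -/
theorem levelCdf_eq_missOp [Nonempty A] {M : MDP S A} (hγ : 0 < M.γ) {v : S → Level → ℝ}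
    (h : ∀ s (α : Level), M.missOp (levelCdf v) s (v s α) = ENNReal.ofReal α) (s : S) (x : ℝ) :
    M.missOp (levelCdf v) s x = levelCdf v s x := by
  have hmono := M.monotone_missOp hγ (monotone_levelCdf v) s
  have hone := M.missOp_le_one (levelCdf_le_one v) s x
  refine le_antisymm ?_ ?_
  · rw [← uniformLevel_lt hone]
    refine measure_mono fun u (hu : ENNReal.ofReal u < _) =>
      show v s u < x from lt_of_not_ge fun hx => ?_
    exact absurd (hu.trans_le ((hmono hx).trans_eq (h s u))) (lt_irrefl _)
  · refine le_trans (measure_mono fun u (hu : v s u < x) => ?_) (uniformLevel_le hone)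
    exact (h s u).symm.trans_le (hmono hu.le)

/-- Fixed points of `missOp` that interleave up to a shift interleave up to discounted shifts. -/
theorem le_shift_pow {M : MDP S A} (hγ : 0 < M.γ) {F G : S → ℝ → ℝ≥0∞}
    (hF : ∀ s x, M.missOp F s x = F s x) (hG : ∀ s x, M.missOp G s x = G s x) {d : ℝ}
    (h : ∀ s x, F s x ≤ G s (x + d)) (n : ℕ) (s : S) (x : ℝ) :
    F s x ≤ G s (x + M.γ ^ n * d) := by
  induction n generalizing s x with
  | zero => simpa using h s x
  | succ n ih =>
    have h' := M.missOp_mono ih s x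
    rwa [hF, M.missOp_shift hγ, hG, ← mul_assoc, ← pow_succ'] at h'

theorem le_of_lt_of_le_shift {M : MDP S A} (hγ : 0 < M.γ) (hγ1 : M.γ < 1)
    {F G : S → ℝ → ℝ≥0∞} (hF : ∀ s x, M.missOp F s x = F s x)
    (hG : ∀ s x, M.missOp G s x = G s x) (hmono : ∀ s, Monotone (G s)) {d : ℝ}
    (h : ∀ s x, F s x ≤ G s (x + d)) (s : S) {x y : ℝ} (hxy : x < y) : F s x ≤ G s y := by
  have hlim : Tendsto (fun n => x + M.γ ^ n * d) atTop (𝓝 x) := by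
    simpa using ((tendsto_pow_atTop_nhds_zero_of_lt_one hγ.le hγ1).mul_const d).const_add x
  obtain ⟨n, hn⟩ := (hlim.eventually (gt_mem_nhds hxy)).exists
  exact (le_shift_pow hγ hF hG h n s x).trans (hmono s hn.le)

theorem minMissProb_le_ofReal_bddAbove [Nonempty A] {M : MDP S A} {c : ℝ} (s : S) (α : Level) :
    c ∈ upperBounds {x | M.minMissProb c s x ≤ ENNReal.ofReal α} := fun x hx =>
  le_of_not_gt fun hcx => by
    rw [Set.mem_ofPred_eq, minMissProb_eq_one hcx, ENNReal.one_le_ofReal] at hx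
    exact absurd α.2.2 (not_lt.2 hx)

/-! ### The optimal value as a generalized inverse. -/

section Optimal

variable [Finite A] [Nonempty A] {M : MDP S A} {R c : ℝ}

theorem isGreatest_returnVaR [MeasurableSingletonClass A] (hγ : 0 < M.γ) (hγ1 : M.γ < 1)
    (hR : ∀ s a, ∀ᵐ p ∂(M.trans (s, a)), |p.1| ≤ R) (hc : M.γ * c + R = c) (hc0 : 0 ≤ c)
    (s : S) (α : Level) :
    IsGreatest (Set.range fun π : HistoryPolicy S A => M.returnVaR π s α)
      (sSup {x | M.minMissProb c s x ≤ ENNReal.ofReal α}) ∧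
    ∀ x, x ≤ sSup {x | M.minMissProb c s x ≤ ENNReal.ofReal α} ↔
      M.minMissProb c s x ≤ ENNReal.ofReal α := by
  set B := {x | M.minMissProb c s x ≤ ENNReal.ofReal α} with hB
  have hbdd : BddAbove B := ⟨c, minMissProb_le_ofReal_bddAbove s α⟩
  have hne : B.Nonempty := ⟨-c, by
    rw [hB, Set.mem_ofPred_eq, minMissProb_eq_zero hγ hR hc hc0 le_rfl]; exact zero_le⟩
  have hmem : sSup B ∈ B := M.minMissProb_le_of_forall_lt hγ c s fun y hy => by
    obtain ⟨b, hb, hyb⟩ := exists_lt_of_lt_csSup hne hy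
    exact (M.monotone_minMissProb hγ c s hyb.le).trans hb
  have hle : ∀ π : HistoryPolicy S A, M.returnVaR π s α ≤ sSup B := fun π =>
    VaR_le M.measurable_discountedReturn α.2.1 fun x hx => le_csSup hbdd
      ((minMissProb_le_trajLaw hγ hγ1 hR hc π s x).trans ((real_le_iff_le_ofReal α.2.1.le).1 hx))
  refine ⟨⟨?_, ?_⟩, fun x => ⟨fun hx => (M.monotone_minMissProb hγ c s hx).trans hmem,
    fun hx => le_csSup hbdd hx⟩⟩
  -- The policy that is greedy for the target `sSup B` itself is optimal; `hmem`, from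
  -- left-continuity, bounds its miss probability by `α`.
  · obtain ⟨π, hπ⟩ := exists_policy_trajLaw_le hγ hγ1 hR hc (sSup B)
    refine ⟨π, le_antisymm (hle π) (le_VaR M.measurable_discountedReturn α.2.2 ?_)⟩
    exact (real_le_iff_le_ofReal α.2.1.le).2 ((hπ s).trans hmem)
  · rintro _ ⟨π, rfl⟩
    exact hle π

theorem isGreatest_vStar [MeasurableSingletonClass A] (hγ : 0 < M.γ) (hγ1 : M.γ < 1)
    (hR : ∀ s a, ∀ᵐ p ∂(M.trans (s, a)), |p.1| ≤ R) (hc : M.γ * c + R = c) (hc0 : 0 ≤ c)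
    (s : S) (α : Level) :
    IsGreatest (Set.range fun π : HistoryPolicy S A => M.returnVaR π s α) (M.vStar s α) := by
  have h := (isGreatest_returnVaR hγ hγ1 hR hc hc0 s α).1
  exact (show M.vStar s α = _ from h.csSup_eq) ▸ h

theorem le_vStar_iff [MeasurableSingletonClass A] (hγ : 0 < M.γ) (hγ1 : M.γ < 1)
    (hR : ∀ s a, ∀ᵐ p ∂(M.trans (s, a)), |p.1| ≤ R) (hc : M.γ * c + R = c) (hc0 : 0 ≤ c)
    (s : S) (α : Level) (x : ℝ) :
    x ≤ M.vStar s α ↔ M.minMissProb c s x ≤ ENNReal.ofReal α := by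
  have h := isGreatest_returnVaR hγ hγ1 hR hc hc0 s α
  rw [show M.vStar s α = _ from h.1.csSup_eq]
  exact h.2 x

theorem isValueFunction_vStar [MeasurableSingletonClass A] (hγ : 0 < M.γ) (hγ1 : M.γ < 1)
    (hR : ∀ s a, ∀ᵐ p ∂(M.trans (s, a)), |p.1| ≤ R) (hc : M.γ * c + R = c) (hc0 : 0 ≤ c) :
    IsValueFunction M.vStar := by
  have hiff := le_vStar_iff hγ hγ1 hR hc hc0
  refine ⟨measurable_of_Ici fun x => ?_, c, fun s α => abs_le.2 ⟨?_, ?_⟩⟩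
  · have : Function.uncurry M.vStar ⁻¹' Set.Ici x
        = {q : S × Level | M.minMissProb c q.1 x ≤ ENNReal.ofReal q.2} :=
      Set.ext fun q => hiff q.1 q.2 x
    rw [this]
    refine measurableSet_le ?_ (by fun_prop)
    exact (M.measurable_minMissProb c).comp (f := fun q : S × Level => (q.1, x)) (by fun_prop)
  · rw [hiff, minMissProb_eq_zero hγ hR hc hc0 le_rfl]
    exact zero_le
  · exact minMissProb_le_ofReal_bddAbove s α ((hiff s α _).1 le_rfl)

theorem levelCdf_vStar [MeasurableSingletonClass A] (hγ : 0 < M.γ) (hγ1 : M.γ < 1)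
    (hR : ∀ s a, ∀ᵐ p ∂(M.trans (s, a)), |p.1| ≤ R) (hc : M.γ * c + R = c) (hc0 : 0 ≤ c) :
    levelCdf M.vStar = M.minMissProb c := by
  funext s x
  rw [← uniformLevel_lt (M.minMissProb_le_one c s x)]
  refine congrArg uniformLevel (Set.ext fun u => ?_)
  exact lt_iff_lt_of_le_iff_le (le_vStar_iff hγ hγ1 hR hc hc0 s u x)

end Optimal

/-- Right-continuity: absolute continuity excludes an atom of the target at `x`, for each action
separately. -/
theorem le_missOp_levelCdf_of_forall_gt {M : MDP S A} (hγ : 0 < M.γ) {v : S → Level → ℝ}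
    (hv : Measurable (Function.uncurry v))
    (hd : ∀ s a, (M.sampleLaw s a).map (M.target v) ≪ volume) (s : S) {x : ℝ} {t : ℝ≥0∞}
    (h : ∀ y, x < y → t ≤ M.missOp (levelCdf v) s y) : t ≤ M.missOp (levelCdf v) s x := by
  refine le_iInf fun a => ?_
  have hX := M.measurable_target hv
  obtain ⟨u, hu, hxu, hlim⟩ := exists_seq_strictAnti_tendsto x
  have hle : ∀ k, t ≤ M.sampleLaw s a {p | M.target v p < u k} := fun k => by
    rw [M.sampleLaw_target_lt hγ hv]
    exact (h _ (hxu k)).trans (iInf_le _ a)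
  have hcont := tendsto_measure_iInter_atTop (μ := M.sampleLaw s a)
    (s := fun k => {p | M.target v p < u k})
    (fun k => (measurableSet_lt hX measurable_const).nullMeasurableSet)
    (fun i j hij p (hp : _ < u j) => hp.trans_le (hu.antitone hij)) ⟨0, measure_ne_top _ _⟩
  refine (ge_of_tendsto' hcont hle).trans ?_
  have hzero : M.sampleLaw s a {p | M.target v p = x} = 0 := by
    have := hd s a (show volume {x} = 0 by simp)
    rwa [Measure.map_apply hX (measurableSet_singleton x)] at this
  rw [← M.sampleLaw_target_lt hγ hv]
  have hsub : ⋂ k, {p | M.target v p < u k}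
      ⊆ {p | M.target v p < x} ∪ {p | M.target v p = x} := fun p hp => by
    have hpx : M.target v p ≤ x := ge_of_tendsto' hlim fun k => (Set.mem_iInter.1 hp k).le
    exact hpx.lt_or_eq
  calc M.sampleLaw s a (⋂ k, {p | M.target v p < u k})
      ≤ M.sampleLaw s a {p | M.target v p < x} + M.sampleLaw s a {p | M.target v p = x} :=
        (measure_mono hsub).trans (measure_union_le _ _)
    _ = M.sampleLaw s a {p | M.target v p < x} := by rw [hzero, add_zero]

end MDP

/-! ### Fixed point and uniqueness. -/

theorem proposition2 {S A : Type*} [MeasurableSpace S] [MeasurableSpace A]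
    [MeasurableSingletonClass A] [Finite A] [Nonempty A] (M : MDP S A)
    (hγ_pos : 0 < M.γ) (hγ_lt : M.γ < 1)
    (h_bdd : ∃ R : ℝ, ∀ s a, ∀ᵐ p ∂(M.trans (s, a)), |p.1| ≤ R)
    (h_density : ∀ s a, (M.sampleLaw s a).map (M.target M.vStar) ≪ volume)
    (h_quantile : ∀ s a (α : Level),
      lowerQuantile (M.sampleLaw s a) (M.target M.vStar) α
        = VaR (M.sampleLaw s a) (M.target M.vStar) α)
    (η : ℝ) (hη : 0 < η) :
    (∀ s α, IsGreatest (Set.range fun π : HistoryPolicy S A => M.returnVaR π s α) (M.vStar s α)) ∧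
    MDP.IsValueFunction M.vStar ∧
    Function.IsFixedPt (M.bellmanOp 0 0 η) M.vStar ∧
    ∀ v : S → Level → ℝ, MDP.IsValueFunction v →
      Function.IsFixedPt (M.bellmanOp 0 0 η) v → v = M.vStar := by
  obtain ⟨R₀, hR₀⟩ := h_bdd
  have hR : ∀ s a, ∀ᵐ p ∂(M.trans (s, a)), |p.1| ≤ |R₀| := fun s a =>
    (hR₀ s a).mono fun p hp => hp.trans (le_abs_self _)
  have h1γ : 0 < 1 - M.γ := sub_pos.2 hγ_lt
  -- `c` is the geometric bound on the return; using `|R₀|` makes it nonnegative.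
  obtain ⟨c, hc, hc0⟩ : ∃ c, M.γ * c + |R₀| = c ∧ 0 ≤ c :=
    ⟨|R₀| / (1 - M.γ), by field_simp; ring, by positivity⟩
  have hiff := MDP.le_vStar_iff hγ_pos hγ_lt hR hc hc0
  have hval := MDP.isValueFunction_vStar hγ_pos hγ_lt hR hc hc0
  have hcdf := MDP.levelCdf_vStar hγ_pos hγ_lt hR hc hc0
  have hfix := MDP.missOp_minMissProb hγ_pos hR hc
  have hmono := M.monotone_minMissProb hγ_pos c
  have hright : ∀ s {x : ℝ} {t : ℝ≥0∞}, (∀ y, x < y → t ≤ M.minMissProb c s y) →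
      t ≤ M.minMissProb c s x := fun s x t h => by
    have := MDP.le_missOp_levelCdf_of_forall_gt hγ_pos hval.1 h_density s (x := x) (t := t)
    simp only [hcdf, hfix] at this
    exact this h
  have hlevel : ∀ s (α : Level), M.minMissProb c s (M.vStar s α) = ENNReal.ofReal α := fun s α =>
    le_antisymm ((hiff s α _).1 le_rfl)
      (hright s fun y hy => le_of_not_ge fun h => absurd ((hiff s α y).2 h) (not_le.2 hy))
  refine ⟨MDP.isGreatest_vStar hγ_pos hγ_lt hR hc hc0, hval, ?_, ?_⟩
  · rw [M.isFixedPt_bellmanOp_iff hγ_pos hη hval.1]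
    simpa only [hcdf, hfix] using hlevel
  rintro v ⟨hvm, C, hC⟩ hv
  rw [M.isFixedPt_bellmanOp_iff hγ_pos hη hvm] at hv
  have hvfix := MDP.levelCdf_eq_missOp hγ_pos hv
  have hvcdf : ∀ s x, MDP.levelCdf v s x = M.minMissProb c s x := fun s x => by
    refine le_antisymm (hright s fun y hy => ?_)
      (M.minMissProb_le_of_forall_lt hγ_pos c s fun y hy => ?_)
    -- The shift `c + C` is crude: for `x ≤ -C` the left side vanishes, and for `x > -C` the shifted
    -- target exceeds `c`, so the right side is `1`. The reverse comparison swaps the roles of `c`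
    -- and `C`.
    · refine MDP.le_of_lt_of_le_shift hγ_pos hγ_lt hvfix hfix hmono (d := c + C)
        (fun s x => ?_) s hy
      rcases le_or_gt x (-C) with hx | hx
      · have : {u | v s u < x} = ∅ := Set.eq_empty_of_forall_notMem fun u (hu : v s u < x) => by
          linarith [(abs_le.1 (hC s u)).1]
        simp [MDP.levelCdf, this]
      · rw [MDP.minMissProb_eq_one (by linarith)]
        exact MDP.levelCdf_le_one v s x
    · refine MDP.le_of_lt_of_le_shift hγ_pos hγ_lt hfix hvfix (MDP.monotone_levelCdf v)
        (d := c + C) (fun s x => ?_) s hy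
      rcases le_or_gt x (-c) with hx | hx
      · rw [MDP.minMissProb_eq_zero hγ_pos hR hc hc0 hx]
        exact zero_le
      · have : {u | v s u < x + (c + C)} = Set.univ := Set.eq_univ_of_forall fun u => by
          rw [Set.mem_ofPred_eq]; linarith [(abs_le.1 (hC s u)).2]
        simp only [MDP.levelCdf, this, measure_univ]
        exact M.minMissProb_le_one c s x
  funext s α
  have hvα : M.minMissProb c s (v s α) = ENNReal.ofReal α := by
    rw [← hvcdf, ← hvfix, hv]
  refine le_antisymm ((hiff s α _).2 hvα.le) (le_of_not_gt fun hlt => ?_)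
  -- Take an action optimal for the target `v*(s,α)`: it misses that target with probability exactly
  -- `α`, so its upper quantile is at least `v*(s,α)`. It misses `v(s,α)` with probability at least
  -- the minimum, again `α`, so its lower quantile is at most `v(s,α)`.
  obtain ⟨a, ha⟩ := M.exists_actionMissProb_eq_missOp (M.minMissProb c) s (M.vStar s α)
  have hprob := M.sampleLaw_target_lt hγ_pos hval.1 s a
  rw [hcdf] at hprob
  have hX := M.measurable_target hval.1
  have hupper : M.vStar s α ≤ VaR (M.sampleLaw s a) (M.target M.vStar) α :=
    le_VaR hX α.2.2 ((real_le_iff_le_ofReal α.2.1.le).2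
      (by rw [hprob, ha, hfix, hlevel]))
  have hlower : lowerQuantile (M.sampleLaw s a) (M.target M.vStar) α ≤ v s α := by
    refine lowerQuantile_le hX α.2.1 ?_
    rw [measureReal_def, ← ENNReal.ofReal_le_iff_le_toReal (measure_ne_top _ _), ← hvα,
      ← hfix]
    refine (iInf_le _ a).trans ((hprob _).symm.trans_le ?_)
    exact measure_mono fun p (hp : M.target M.vStar p < v s α) => hp.le
  exact absurd (hupper.trans ((h_quantile s a α).symm.trans_le hlower)) (not_le.2 hlt)
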